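/- Let $n\ge 2$, $V=[n]$, let $E(K_n)$ be the edge set of the complete graph on $V$, and let $w:E(K_n)\to\mathbb{R}_{>0}$. For $E\subseteq E(K_n)$ put $t_w(E)=\sum_T\prod_{e\in E(T)}w(e)$, where $T$ runs over the spanning trees of the graph $(V,E)$, and let $\mathrm{logtree}(E)=\log t_w(E)$ if $t_w(E)>0$ and $\mathrm{logtree}(E)=0$ otherwise. Let $(V,E_{\rm init})$ be a connected graph, let $\mathcal M^+\subseteq E(K_n)\setminus E_{\rm init}$ and let $0\le k\le|\mathcal M^+|$. Let $$\mathsf{OPT}=\max\{\mathrm{logtree}(E\cup E_{\rm init}) : E\subseteq\mathcal M^+,\ |E|=k\},\qquad \tau_{\rm init}=\mathrm{logtree}(E_{\rm init}).$$ Fix an anchor $v_0\in V$. For an edge $e=\{u,v\}$ let $a_e=e_u-e_v$ with the coordinate of $v_0$ deleted, and let $L_e=a_ea_e^\top$ (the choice of sign of $a_e$ does not matter). Let $L_{\rm init}=\sum_{e\in E_{\rm init}}w(e)L_e$. *Greedy algorithm.* Start with $E=\varnothing$ and $L=L_{\rm init}$. While $|E|<k$, choose $e\in\mathcal M^+\setminus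 E$ that maximizes $w(e)\,a_e^\top L^{-1}a_e$ (ties are broken arbitrarily), and replace $E$ by $E\cup\{e\}$ and $L$ by $L+w(e)L_e$. Let $E_{\rm greedy}$ be the set $E$ that is returned and let $\tau_{\rm greedy}=\mathrm{logtree}(E_{\rm greedy}\cup E_{\rm init})$. *Convex relaxation* $(P_2)$. Maximize $\log\det\big(L_{\rm init}+\sum_{e\in\mathcal M^+}\pi_e\,w(e)L_e\big)$ over $\pi\in\mathbb{R}^{\mathcal M^+}$ subject to $\|\pi\|_1=k$ and $0\le\pi_e\le1$ for all $e\in\mathcal M^+$. Let $\tau^\star_{\rm cvx}$ be its optimum value. Let $E_{\rm cvx}$ consist of $k$ edges $e\in\mathcal M^+$ with the largest $\pi^\star_e$, where $\pi^\star$ is any globally optimal solution of $(P_2)$ (ties are broken arbitrarily), and let $\tau_{\rm cvx}=\mathrm{logtree}(E_{\rm cvx}\cup E_{\rm init})$. Then both maxima are attained, the two algorithms have at least one possible output each, and for all possible outputs $E_{\rm greedy}$, $E_{\rm cvx}$, $$\max\{\tau_{\rm greedy},\tau_{\rm cvx}\}\;\le\;\mathsf{OPT}\;\le\;\min\{\zeta\,\tau_{\rm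 greedy}+(1-\zeta)\,\tau_{\rm init},\ \tau^\star_{\rm cvx}\},\qquad \zeta=(1-1/e)^{-1}.$$ -/

import Mathlib

namespace ESP

noncomputable section

open Matrix

variable {n : ℕ}

/-- The edge set `E(Kₙ)` of the complete graph on the vertex set `Fin n`. -/
abbrev completeEdges (n : ℕ) : Set (Sym2 (Fin n)) := (⊤ : SimpleGraph (Fin n)).edgeSet

/-- The graph `G_E = (V, E)` on `V = Fin n` with edge set `E`. -/
abbrev graphOf (E : Finset (Sym2 (Fin n))) : SimpleGraph (Fin n) :=
  SimpleGraph.fromEdgeSet (E : Set (Sym2 (Fin n)))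

open Classical in
/-- The spanning trees of `G`: the subgraphs of `G` on all of `V` that are trees. -/
def spanningTrees (G : SimpleGraph (Fin n)) : Finset (SimpleGraph (Fin n)) :=
  Finset.univ.filter fun T => T ≤ G ∧ T.IsTree

open Classical in
/-- The value of a spanning tree: the product of the weights of its edges. -/
def treeValue (w : Sym2 (Fin n) → ℝ) (T : SimpleGraph (Fin n)) : ℝ :=
  ∏ e ∈ T.edgeFinset, w e

/-- The weighted number of spanning trees `t_w(G)`. -/
def weightedTreeCount (w : Sym2 (Fin n) → ℝ) (G : SimpleGraph (Fin n)) : ℝ :=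
  ∑ T ∈ spanningTrees G, treeValue w T

open Classical in
/-- The weighted tree-connectivity `τ_w(G)`. -/
def treeConnectivity (w : Sym2 (Fin n) → ℝ) (G : SimpleGraph (Fin n)) : ℝ :=
  if 0 < weightedTreeCount w G then Real.log (weightedTreeCount w G) else 0

/-- The set function `E ↦ τ_w(G_E)`. -/
def logTree (w : Sym2 (Fin n) → ℝ) (E : Finset (Sym2 (Fin n))) : ℝ :=
  treeConnectivity w (graphOf E)

/-! ### The edge selection problem -/

/-- Feasible solutions of `k`-ESP⁺: the `k`-subsets of the candidate set. -/
def espFeasible (M : Finset (Sym2 (Fin n))) (k : ℕ) : Set (Finset (Sym2 (Fin n))) :=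
  {E | E ⊆ M ∧ E.card = k}

/-- The tree-connectivities that are achieved by feasible solutions of `k`-ESP⁺. -/
def espValues (w : Sym2 (Fin n) → ℝ) (Einit M : Finset (Sym2 (Fin n))) (k : ℕ) : Set ℝ :=
  (fun E => logTree w (E ∪ Einit)) '' espFeasible M k

/-- `OPT`, the maximum achievable tree-connectivity in `k`-ESP⁺. -/
def espOPT (w : Sym2 (Fin n) → ℝ) (Einit M : Finset (Sym2 (Fin n))) (k : ℕ) : ℝ :=
  sSup (espValues w Einit M k)

/-! ### Reduced Laplacians, anchored at a vertex `v₀` -/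

/-- The column `a_uv = e_u - e_v` of the reduced incidence matrix (the row of `v₀` is removed). -/
def incVec (v₀ : Fin n) (u v : Fin n) : {i : Fin n // i ≠ v₀} → ℝ :=
  fun i => (if (i : Fin n) = u then 1 else 0) - (if (i : Fin n) = v then 1 else 0)

theorem incVec_swap (v₀ u v : Fin n) : incVec v₀ u v = -incVec v₀ v u := by
  funext i; simp [incVec]

/-- The elementary reduced Laplacian `L_uv = a_uv a_uvᵀ`, as a function of the edge `{u, v}`. -/
def elemLaplacian (v₀ : Fin n) :
    Sym2 (Fin n) → Matrix {i : Fin n // i ≠ v₀} {i : Fin n // i ≠ v₀} ℝ :=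
  Sym2.lift ⟨fun u v => vecMulVec (incVec v₀ u v) (incVec v₀ u v), fun u v => by
    ext i j; simp [incVec_swap v₀ u v, vecMulVec_apply]⟩

/-- The reduced weighted Laplacian of `(V, E, w)`. -/
def redLaplacian (v₀ : Fin n) (w : Sym2 (Fin n) → ℝ) (E : Finset (Sym2 (Fin n))) :
    Matrix {i : Fin n // i ≠ v₀} {i : Fin n // i ≠ v₀} ℝ :=
  ∑ e ∈ E, w e • elemLaplacian v₀ e

/-- `Δ_uv = a_uvᵀ L⁻¹ a_uv`, as a function of the edge `{u, v}`. -/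
def reff (v₀ : Fin n) (L : Matrix {i : Fin n // i ≠ v₀} {i : Fin n // i ≠ v₀} ℝ) :
    Sym2 (Fin n) → ℝ :=
  Sym2.lift ⟨fun u v => incVec v₀ u v ⬝ᵥ (L⁻¹ *ᵥ incVec v₀ u v), fun u v => by
    simp [incVec_swap v₀ u v, mulVec_neg]⟩

/-! ### The greedy algorithm -/

/-- `e` is a possible answer of the subroutine that searches `S` for an edge with the largest
`w_e Δ_e`; ties may be broken in any way. -/
def IsBestEdge (v₀ : Fin n) (w : Sym2 (Fin n) → ℝ)
    (L : Matrix {i : Fin n // i ≠ v₀} {i : Fin n // i ≠ v₀} ℝ)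
    (S : Finset (Sym2 (Fin n))) (e : Sym2 (Fin n)) : Prop :=
  e ∈ S ∧ ∀ f ∈ S, w f * reff v₀ L f ≤ w e * reff v₀ L e

/-- The reachable states `(E, L)` of the greedy algorithm: it starts from `(∅, L_init)`, and each
round adds a best remaining candidate edge `e` to `E` and updates `L` to `L + w_e a_e a_eᵀ`. -/
inductive GreedyState (v₀ : Fin n) (w : Sym2 (Fin n) → ℝ) (Einit M : Finset (Sym2 (Fin n))) :
    Finset (Sym2 (Fin n)) → Matrix {i : Fin n // i ≠ v₀} {i : Fin n // i ≠ v₀} ℝ → Prop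
  | init : GreedyState v₀ w Einit M ∅ (redLaplacian v₀ w Einit)
  | step (E : Finset (Sym2 (Fin n))) (L : Matrix {i : Fin n // i ≠ v₀} {i : Fin n // i ≠ v₀} ℝ)
      (e : Sym2 (Fin n)) (hEL : GreedyState v₀ w Einit M E L)
      (he : IsBestEdge v₀ w L (M \ E) e) :
      GreedyState v₀ w Einit M (insert e E) (L + w e • elemLaplacian v₀ e)

/-- `E` is a set that the greedy algorithm can return for cardinality `k`. -/
def IsGreedyOutput (v₀ : Fin n) (w : Sym2 (Fin n) → ℝ) (Einit M : Finset (Sym2 (Fin n))) (k : ℕ)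
    (E : Finset (Sym2 (Fin n))) : Prop :=
  E.card = k ∧ ∃ L, GreedyState v₀ w Einit M E L

/-! ### The convex relaxation P₂ -/

/-- `L(π) = ∑_{e ∈ E_init} w_e L_e + ∑_{e ∈ M⁺} π_e w_e L_e`. -/
def relaxedLaplacian (v₀ : Fin n) (w : Sym2 (Fin n) → ℝ) (Einit M : Finset (Sym2 (Fin n)))
    (p : M → ℝ) : Matrix {i : Fin n // i ≠ v₀} {i : Fin n // i ≠ v₀} ℝ :=
  ∑ e ∈ Einit, w e • elemLaplacian v₀ e +
    ∑ e : M, p e • w (e : Sym2 (Fin n)) • elemLaplacian v₀ (e : Sym2 (Fin n))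

/-- The feasible set `‖π‖₁ = k`, `0 ≤ π_e ≤ 1`. -/
def cvxFeasible (M : Finset (Sym2 (Fin n))) (k : ℕ) : Set (M → ℝ) :=
  {p | ∑ e, |p e| = (k : ℝ) ∧ ∀ e, 0 ≤ p e ∧ p e ≤ 1}

/-- The objective function `log det L(π)`. -/
def cvxObjective (v₀ : Fin n) (w : Sym2 (Fin n) → ℝ) (Einit M : Finset (Sym2 (Fin n)))
    (p : M → ℝ) : ℝ :=
  Real.log (relaxedLaplacian v₀ w Einit M p).det

/-- The values of the objective function on the feasible set. -/
def cvxValues (v₀ : Fin n) (w : Sym2 (Fin n) → ℝ) (Einit M : Finset (Sym2 (Fin n)))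
    (k : ℕ) : Set ℝ :=
  cvxObjective v₀ w Einit M '' cvxFeasible M k

/-- `τ*_cvx`, the optimum value of P₂. -/
def cvxOPT (v₀ : Fin n) (w : Sym2 (Fin n) → ℝ) (Einit M : Finset (Sym2 (Fin n))) (k : ℕ) : ℝ :=
  sSup (cvxValues v₀ w Einit M k)

/-- `p` is a globally optimal solution of P₂. -/
def IsCvxSolution (v₀ : Fin n) (w : Sym2 (Fin n) → ℝ) (Einit M : Finset (Sym2 (Fin n))) (k : ℕ)
    (p : M → ℝ) : Prop :=
  p ∈ cvxFeasible M k ∧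
    ∀ q ∈ cvxFeasible M k, cvxObjective v₀ w Einit M q ≤ cvxObjective v₀ w Einit M p

/-- `E` consists of `k` candidate edges with the largest `π_e`. -/
def IsTopEdges (M : Finset (Sym2 (Fin n))) (k : ℕ) (p : M → ℝ) (E : Finset (Sym2 (Fin n))) :
    Prop :=
  E ⊆ M ∧ E.card = k ∧
    ∀ e f : M, (e : Sym2 (Fin n)) ∈ E → (f : Sym2 (Fin n)) ∉ E → p f ≤ p e

/-- `E` is a set that the convex approximation algorithm can return: solve P₂ to global
optimality and pick `k` edges with the largest entries of the solution. -/
def IsCvxOutput (v₀ : Fin n) (w : Sym2 (Fin n) → ℝ) (Einit M : Finset (Sym2 (Fin n))) (k : ℕ)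
    (E : Finset (Sym2 (Fin n))) : Prop :=
  ∃ p : M → ℝ, IsCvxSolution v₀ w Einit M k p ∧ IsTopEdges M k p E

end

end ESP

/-! By the matrix tree theorem the spanning trees of a connected graph are counted by the
determinant of its reduced Laplacian (`det_redLaplacian`), so the problem is to maximize `log det`
over sums of rank one matrices. Two properties of `log det` give the greedy bound: it is monotone,
and the gain from adding an edge shrinks as edges are added, since inversion is antitone in the
Loewner order (`dotProduct_inv_add_le`, `log_det_add_sum_le`). Hence a best edge closes at least
`1/k` of the gap to an optimal set, and after `k` rounds at most `(1 - 1/k)^k ≤ 1/e` of the initial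
gap is left (`GreedyState.gap_le`). The bound by the relaxation holds because the indicator of a
feasible set is feasible there with the same value; its maximum exists by compactness. -/

namespace ESP

open Matrix

/-! ### Cauchy–Binet for weighted sums of rank one matrices. -/

section CauchyBinet

variable {R m ι : Type*} [CommRing R] [Fintype m] [DecidableEq m]

/-- Row `i` of the sum is a linear combination of the vectors `a e`, so the determinant expands by
multilinearity over all choices `r` of one index per row. -/
theorem det_sum_vecMulVec (w : ι → R) (a : ι → m → R) (S : Finset ι) :
    (∑ e ∈ S, w e • vecMulVec (a e) (a e)).det =
      ∑ r ∈ Fintype.piFinset (fun _ : m => S),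
        (∏ i, w (r i)) * ((∏ i, a (r i) i) * (Matrix.of fun i => a (r i)).det) := by
  have h : (∑ e ∈ S, w e • vecMulVec (a e) (a e)) =
      fun i => ∑ e ∈ S, (w e * a e i) • a e := by
    ext i j
    simp [Matrix.sum_apply, vecMulVec_apply, mul_assoc]
  have h2 := (detRowAlternating (n := m) (R := R)).toMultilinearMap.map_sum_finset
    (fun i e => (w e * a e i) • a e) (fun _ => S)
  rw [h]
  refine h2.trans (Finset.sum_congr rfl fun r _ => ?_)
  refine (MultilinearMap.map_smul_univ _ _ _).trans ?_
  rw [Finset.prod_mul_distrib, smul_eq_mul, mul_assoc]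
  rfl

theorem sum_perm_prod_mul_det (b : m → m → R) :
    ∑ σ : Equiv.Perm m, (∏ i, b (σ i) i) * (Matrix.of fun i => b (σ i)).det =
      (Matrix.of b).det ^ 2 := by
  rw [sq, det_apply' (Matrix.of b), Finset.sum_mul]
  refine Finset.sum_congr rfl fun σ _ => ?_
  have : (Matrix.of fun i => b (σ i)) = (Matrix.of b).submatrix σ id := rfl
  rw [this, det_permute, ← det_apply']
  simp only [of_apply]
  ring

/-- The **Cauchy–Binet formula** for a weighted sum of rank one matrices. -/
theorem det_sum_vecMulVec_eq_sum_powersetCard (w : ι → R) (a : ι → m → R) (S : Finset ι)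
    (D : Finset ι → R)
    (hD : ∀ T ⊆ S, ∀ f : m ≃ T, (Matrix.of fun i => a (f i)).det ^ 2 = D T) :
    (∑ e ∈ S, w e • vecMulVec (a e) (a e)).det =
      ∑ T ∈ S.powersetCard (Fintype.card m), (∏ e ∈ T, w e) * D T := by
  classical
  rw [det_sum_vecMulVec]
  -- A non-injective `r` repeats a row, so its determinant vanishes.
  rw [← Finset.sum_filter_of_ne (p := fun r : m → ι => Function.Injective r)]
  swap
  · intro r _ hr
    by_contra hinj
    simp only [Function.Injective, not_forall] at hinj
    obtain ⟨i, j, hij, hne⟩ := hinj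
    refine hr ?_
    rw [det_zero_of_row_eq hne (by ext; simp [hij])]
    simp
  -- Group the injective choices by their image `T`; with one enumeration `f` of `T` fixed, each
  -- fibre is a copy of the permutations of `m`.
  rw [← Finset.sum_fiberwise_of_maps_to (t := S.powersetCard (Fintype.card m))
    (g := fun r : m → ι => Finset.univ.image r)]
  swap
  · intro r hr
    simp only [Finset.mem_filter, Fintype.mem_piFinset] at hr
    rw [Finset.mem_powersetCard]
    refine ⟨?_, ?_⟩
    · intro e he
      obtain ⟨i, _, rfl⟩ := Finset.mem_image.1 he
      exact hr.1 i
    · rw [Finset.card_image_of_injective _ hr.2, Finset.card_univ]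
  refine Finset.sum_congr rfl fun T hT => ?_
  obtain ⟨hTS, hTc⟩ := Finset.mem_powersetCard.1 hT
  obtain ⟨f⟩ : Nonempty (m ≃ T) := Fintype.card_eq.1 (by simp [hTc])
  rw [← hD T hTS f, ← sum_perm_prod_mul_det, Finset.mul_sum]
  symm
  have hw : ∀ σ : Equiv.Perm m, ∏ i, w (f (σ i)) = ∏ e ∈ T, w e := fun σ => by
    rw [← Finset.prod_coe_sort T w]
    exact Equiv.prod_comp (σ.trans f) (fun e : T => w e)
  refine Finset.sum_bij (fun σ _ i => (f (σ i) : ι)) ?_ ?_ ?_ ?_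
  · intro σ _
    simp only [Finset.mem_filter, Fintype.mem_piFinset]
    refine ⟨⟨fun i => hTS (f (σ i)).2, ?_⟩, ?_⟩
    · exact Subtype.val_injective.comp (f.injective.comp σ.injective)
    · ext e
      simp only [Finset.mem_image, Finset.mem_univ, true_and]
      constructor
      · rintro ⟨i, rfl⟩
        exact (f (σ i)).2
      · intro he
        exact ⟨σ.symm (f.symm ⟨e, he⟩), by simp⟩
  · intro σ _ τ _ h
    ext i
    exact f.injective (Subtype.ext (congrFun h i))
  · intro r hr
    simp only [Finset.mem_filter, Fintype.mem_piFinset] at hr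
    obtain ⟨⟨_, hinj⟩, him⟩ := hr
    have hmem : ∀ i, r i ∈ T := fun i => him ▸ Finset.mem_image_of_mem r (Finset.mem_univ i)
    let g : m → m := fun i => f.symm ⟨r i, hmem i⟩
    have hg : Function.Injective g := fun i j hij =>
      hinj (congrArg Subtype.val (f.symm.injective hij))
    refine ⟨Equiv.ofBijective g (Finite.injective_iff_bijective.1 hg), Finset.mem_univ _, ?_⟩
    funext i
    simp [g]
  · intro σ _
    rw [hw]

end CauchyBinet

/-! ### Reduced incidence vectors. -/

section Incidence

variable {n : ℕ}

/-- The column of the reduced incidence matrix for an edge with an arbitrary orientation. -/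
noncomputable def edgeVec (v₀ : Fin n) (e : Sym2 (Fin n)) : {i : Fin n // i ≠ v₀} → ℝ :=
  incVec v₀ (Quot.out e).1 (Quot.out e).2

theorem mk_out (e : Sym2 (Fin n)) : s((Quot.out e).1, (Quot.out e).2) = e := Quot.out_eq e

theorem elemLaplacian_eq (v₀ : Fin n) (e : Sym2 (Fin n)) :
    elemLaplacian v₀ e = vecMulVec (edgeVec v₀ e) (edgeVec v₀ e) := by
  conv_lhs => rw [← mk_out e]
  rfl

theorem reff_eq (v₀ : Fin n) (L : Matrix {i : Fin n // i ≠ v₀} {i : Fin n // i ≠ v₀} ℝ)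
    (e : Sym2 (Fin n)) :
    reff v₀ L e = edgeVec v₀ e ⬝ᵥ (L⁻¹ *ᵥ edgeVec v₀ e) := by
  conv_lhs => rw [← mk_out e]
  rfl

/-- The deleted coordinate contributes nothing because `x` vanishes at the anchor. -/
theorem incVec_dotProduct (v₀ u v : Fin n) (x : Fin n → ℝ) (hx : x v₀ = 0) :
    incVec v₀ u v ⬝ᵥ (fun i => x i) = x u - x v := by
  have h : ∑ i : {i : Fin n // i ≠ v₀},
      ((if (i : Fin n) = u then 1 else 0) - (if (i : Fin n) = v then 1 else 0)) * x i =
      ∑ i : Fin n, ((if i = u then 1 else 0) - (if i = v then 1 else 0)) * x i := by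
    rw [← Finset.sum_subtype (Finset.univ.erase v₀) (p := fun i => i ≠ v₀) (by simp)
      (fun i => ((if i = u then 1 else 0) - (if i = v then 1 else 0)) * x i)]
    rw [← Finset.add_sum_erase _ _ (Finset.mem_univ v₀), hx, mul_zero, zero_add]
  refine h.trans ?_
  simp [sub_mul, Finset.sum_sub_distrib]

end Incidence

/-! ### The weighted matrix tree theorem. -/

section MatrixTree

variable {n : ℕ}

/-- The integral version of `incVec`. -/
def intIncVec (v₀ : Fin n) (u v : Fin n) : {i : Fin n // i ≠ v₀} → ℤ :=
  fun i => (if (i : Fin n) = u then 1 else 0) - (if (i : Fin n) = v then 1 else 0)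

theorem intIncVec_add (v₀ u v x : Fin n) :
    intIncVec v₀ u v + intIncVec v₀ v x = intIncVec v₀ u x := by
  funext i; simp [intIncVec]

theorem intIncVec_swap (v₀ u v : Fin n) : intIncVec v₀ u v = -intIncVec v₀ v u := by
  funext i; simp [intIncVec]

/-- Rows telescope along a path from `u` to `v₀`, so every standard basis vector is an integral
combination of rows. The integer matrix thus has an integral left inverse, and its determinant is
`±1`. -/
theorem det_incidence_sq_of_connected (v₀ : Fin n) {T : Finset (Sym2 (Fin n))}
    (hT : (graphOf T).Connected) (f : {i : Fin n // i ≠ v₀} ≃ T) :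
    (Matrix.of fun i => edgeVec v₀ (f i)).det ^ 2 = 1 := by
  set M : Matrix {i : Fin n // i ≠ v₀} {i : Fin n // i ≠ v₀} ℤ :=
    Matrix.of fun i => intIncVec v₀ (Quot.out (f i).1).1 (Quot.out (f i).1).2 with hM
  have hcast : (Matrix.of fun i => edgeVec v₀ (f i)) = M.map (Int.cast : ℤ → ℝ) := by
    ext i j
    simp [hM, intIncVec, edgeVec, incVec]
  have hrow : ∀ u v, (graphOf T).Adj u v → ∃ c, c ᵥ* M = intIncVec v₀ u v := by
    intro u v huv
    have hmem : s(u, v) ∈ T := by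
      have := (SimpleGraph.fromEdgeSet_adj _).1 huv
      exact_mod_cast this.1
    obtain ⟨i, hi⟩ := f.surjective ⟨s(u, v), hmem⟩
    have hout : s((Quot.out (f i).1).1, (Quot.out (f i).1).2) = s(u, v) := by
      rw [mk_out, hi]
    have hs : (Pi.single i (1 : ℤ)) ᵥ* M =
        intIncVec v₀ (Quot.out (f i).1).1 (Quot.out (f i).1).2 := by
      rw [single_one_vecMul]; rfl
    rcases Sym2.eq_iff.1 hout with ⟨h1, h2⟩ | ⟨h1, h2⟩
    · exact ⟨Pi.single i 1, by rw [hs, h1, h2]⟩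
    · exact ⟨-Pi.single i 1, by rw [neg_vecMul, hs, h1, h2, ← intIncVec_swap]⟩
  have hpath : ∀ u v, ∃ c, c ᵥ* M = intIncVec v₀ u v := by
    intro u v
    obtain ⟨p⟩ := hT.preconnected u v
    induction p with
    | nil => exact ⟨0, by funext i; simp [intIncVec]⟩
    | cons h _ ih =>
      obtain ⟨c, hc⟩ := ih
      obtain ⟨d, hd⟩ := hrow _ _ h
      exact ⟨d + c, by rw [add_vecMul, hc, hd, intIncVec_add]⟩
  choose c hc using fun u => hpath u v₀
  have hNM : (Matrix.of fun i : {i : Fin n // i ≠ v₀} => c i) * M = 1 := by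
    ext i j
    have := congrFun (hc i) j
    rw [mul_apply_eq_vecMul]
    refine this.trans ?_
    simp [intIncVec, one_apply, j.2, Subtype.ext_iff, eq_comm]
  have hdet : (M.det) ^ 2 = 1 := by
    have h1 := congrArg det hNM
    rw [det_mul, det_one, mul_comm] at h1
    have := Int.isUnit_iff.1 (IsUnit.of_mul_eq_one _ h1)
    rcases this with h | h <;> simp [h]
  rw [hcast, ← Int.cast_det]
  exact_mod_cast hdet

/-- The indicator `x` of the vertices that cannot be reached from `v₀` is a nonzero kernel vector:
it is constant along every edge. -/
theorem det_incidence_eq_zero_of_not_connected (v₀ : Fin n) {T : Finset (Sym2 (Fin n))}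
    (hloop : (T : Set (Sym2 (Fin n))) ⊆ completeEdges n)
    (hT : ¬ (graphOf T).Connected) (f : {i : Fin n // i ≠ v₀} ≃ T) :
    (Matrix.of fun i => edgeVec v₀ (f i)).det = 0 := by
  classical
  have hex : ∃ u, ¬ (graphOf T).Reachable v₀ u := by
    by_contra! h
    have : Nonempty (Fin n) := ⟨v₀⟩
    exact hT ⟨fun u v => (h u).symm.trans (h v)⟩
  obtain ⟨u, hu⟩ := hex
  let x : Fin n → ℝ := fun i => if (graphOf T).Reachable v₀ i then 0 else 1
  have hx : x v₀ = 0 := if_pos (SimpleGraph.Reachable.refl _)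
  have huv : u ≠ v₀ := by
    rintro rfl
    exact hu (SimpleGraph.Reachable.refl _)
  refine exists_mulVec_eq_zero_iff.1 ⟨fun i => x i, ?_, ?_⟩
  · intro h
    have := congrFun h ⟨u, huv⟩
    simp [x, hu] at this
  · funext i
    refine (incVec_dotProduct v₀ _ _ x hx).trans ?_
    have hadj : (graphOf T).Adj (Quot.out (f i).1).1 (Quot.out (f i).1).2 := by
      rw [← SimpleGraph.mem_edgeSet, mk_out, SimpleGraph.edgeSet_fromEdgeSet]
      refine ⟨(f i).2, ?_⟩
      have := hloop (f i).2
      simpa using SimpleGraph.not_isDiag_of_mem_edgeSet _ this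
    have hiff : (graphOf T).Reachable v₀ (Quot.out (f i).1).1 ↔
        (graphOf T).Reachable v₀ (Quot.out (f i).1).2 :=
      ⟨fun h => h.trans hadj.reachable, fun h => h.trans hadj.symm.reachable⟩
    simp [x, hiff]

theorem edgeSet_graphOf {T : Finset (Sym2 (Fin n))}
    (hloop : (T : Set (Sym2 (Fin n))) ⊆ completeEdges n) : (graphOf T).edgeSet = T := by
  rw [SimpleGraph.edgeSet_fromEdgeSet]
  ext e
  simp only [Set.mem_sdiff, Finset.mem_coe]
  refine ⟨fun h => h.1, fun h => ⟨h, ?_⟩⟩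
  simpa using SimpleGraph.not_isDiag_of_mem_edgeSet _ (hloop h)

theorem edgeFinset_graphOf {T : Finset (Sym2 (Fin n))} {_ : Fintype (graphOf T).edgeSet}
    (hloop : (T : Set (Sym2 (Fin n))) ⊆ completeEdges n) : (graphOf T).edgeFinset = T := by
  ext e
  rw [SimpleGraph.mem_edgeFinset, edgeSet_graphOf hloop, Finset.mem_coe]

theorem isTree_graphOf_iff {T : Finset (Sym2 (Fin n))}
    (hloop : (T : Set (Sym2 (Fin n))) ⊆ completeEdges n) :
    (graphOf T).IsTree ↔ (graphOf T).Connected ∧ T.card + 1 = n := by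
  rw [SimpleGraph.isTree_iff_connected_and_card, edgeSet_graphOf hloop]
  simp

/-- The weighted **matrix tree theorem**. -/
theorem det_redLaplacian (v₀ : Fin n) (w : Sym2 (Fin n) → ℝ) {E : Finset (Sym2 (Fin n))}
    (hE : (E : Set (Sym2 (Fin n))) ⊆ completeEdges n) :
    (redLaplacian v₀ w E).det = weightedTreeCount w (graphOf E) := by
  classical
  have hcard : Fintype.card {i : Fin n // i ≠ v₀} + 1 = n := by
    have h1 : 0 < n := Fin.pos v₀
    rw [Fintype.card_subtype_compl]
    simp
    omega
  unfold redLaplacian weightedTreeCount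
  simp_rw [elemLaplacian_eq]
  rw [det_sum_vecMulVec_eq_sum_powersetCard w (edgeVec v₀) E
    (fun T => if (graphOf T).Connected then 1 else 0)]
  swap
  · intro T hT f
    have hT' : (T : Set (Sym2 (Fin n))) ⊆ completeEdges n := fun e he => hE (hT he)
    split_ifs with h
    · exact det_incidence_sq_of_connected v₀ h f
    · rw [det_incidence_eq_zero_of_not_connected v₀ hT' h f]; simp
  simp only [mul_ite, mul_one, mul_zero]
  rw [← Finset.sum_filter]
  refine Finset.sum_bij' (fun T _ => graphOf T) (fun G _ => G.edgeFinset) ?_ ?_ ?_ ?_ ?_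
  · intro T hT
    simp only [Finset.mem_filter, Finset.mem_powersetCard] at hT
    have hT' : (T : Set (Sym2 (Fin n))) ⊆ completeEdges n := fun e he => hE (hT.1.1 he)
    simp only [spanningTrees, Finset.mem_filter, Finset.mem_univ, true_and]
    exact ⟨SimpleGraph.fromEdgeSet_mono (by exact_mod_cast hT.1.1),
      (isTree_graphOf_iff hT').2 ⟨hT.2, by rw [hT.1.2, hcard]⟩⟩
  · intro G hG
    simp only [spanningTrees, Finset.mem_filter, Finset.mem_univ, true_and] at hG
    simp only [Finset.mem_filter, Finset.mem_powersetCard]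
    refine ⟨⟨?_, ?_⟩, ?_⟩
    · intro e he
      have h1 := SimpleGraph.edgeSet_mono hG.1 (SimpleGraph.mem_edgeFinset.1 he)
      rw [edgeSet_graphOf hE] at h1
      exact h1
    · have := hG.2.card_edgeFinset
      simp only [Fintype.card_fin] at this
      omega
    · simpa [graphOf] using hG.2.connected
  · intro T hT
    simp only [Finset.mem_filter, Finset.mem_powersetCard] at hT
    have hT' : (T : Set (Sym2 (Fin n))) ⊆ completeEdges n := fun e he => hE (hT.1.1 he)
    exact edgeFinset_graphOf hT'
  · intro G hG
    simp [graphOf]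
  · intro T hT
    simp only [Finset.mem_filter, Finset.mem_powersetCard] at hT
    have hT' : (T : Set (Sym2 (Fin n))) ⊆ completeEdges n := fun e he => hE (hT.1.1 he)
    unfold treeValue
    rw [edgeFinset_graphOf hT']

end MatrixTree

/-! ### Monotonicity and submodularity of `log det`. -/

section PosDef

theorem posSemidef_smul_vecMulVec {m : Type*} [Fintype m] {c : ℝ} (hc : 0 ≤ c) (a : m → ℝ) :
    (c • vecMulVec a a).PosSemidef := by
  have := posSemidef_vecMulVec_self_star a
  rw [star_trivial] at this
  exact this.smul hc

variable {m : Type*} [Fintype m] [DecidableEq m]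

/-- The matrix determinant lemma; it turns the greedy score into the gain in `log det`. -/
theorem det_add_smul_vecMulVec {L : Matrix m m ℝ} (hL : IsUnit L.det) (c : ℝ) (a : m → ℝ) :
    (L + c • vecMulVec a a).det = L.det * (1 + c * (a ⬝ᵥ (L⁻¹ *ᵥ a))) := by
  have h : c • vecMulVec a a = replicateCol Unit (c • a) * replicateRow Unit a := by
    rw [← vecMulVec_eq, smul_vecMulVec]
  rw [h, det_add_replicateCol_mul_replicateRow hL]
  congr 1
  simp [dotProduct, mulVec, Matrix.mul_apply, Finset.mul_sum, Finset.sum_mul]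
  rw [Finset.sum_comm]
  refine Finset.sum_congr rfl fun _ _ => Finset.sum_congr rfl fun _ _ => by ring

/-- The inverse of a positive definite matrix is antitone for the Loewner order. -/
theorem dotProduct_inv_add_le {L X : Matrix m m ℝ} (hL : L.PosDef) (hX : X.PosSemidef)
    (a : m → ℝ) : a ⬝ᵥ ((L + X)⁻¹ *ᵥ a) ≤ a ⬝ᵥ (L⁻¹ *ᵥ a) := by
  have hLX : (L + X).PosDef := hL.add_posSemidef hX
  set x := L⁻¹ *ᵥ a with hx
  set y := (L + X)⁻¹ *ᵥ a with hy
  have hLx : L *ᵥ x = a := by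
    rw [hx, mulVec_mulVec, mul_nonsing_inv _ hL.det_pos.ne'.isUnit, one_mulVec]
  have hLy : L *ᵥ y + X *ᵥ y = a := by
    rw [← add_mulVec, hy, mulVec_mulVec, mul_nonsing_inv _ hLX.det_pos.ne'.isUnit, one_mulVec]
  have hsymm : x ⬝ᵥ (L *ᵥ y) = y ⬝ᵥ a := by
    rw [dotProduct_mulVec, ← mulVec_transpose]
    have : L.IsSymm := by simpa using hL.isHermitian
    rw [this.eq, hLx, dotProduct_comm]
  -- Expanded, this reads `x·a - 2 y·a + y·Ly ≥ 0`, while `h2` and `h3` give `y·Ly ≤ y·a`.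
  have h1 : 0 ≤ (x - y) ⬝ᵥ (L *ᵥ (x - y)) := by
    simpa using hL.posSemidef.dotProduct_mulVec_nonneg (x - y)
  have h2 : 0 ≤ y ⬝ᵥ (X *ᵥ y) := by
    simpa using hX.dotProduct_mulVec_nonneg y
  have h3 : y ⬝ᵥ (L *ᵥ y) + y ⬝ᵥ (X *ᵥ y) = y ⬝ᵥ a := by
    rw [← dotProduct_add, hLy]
  simp only [mulVec_sub, sub_dotProduct, dotProduct_sub, hLx, hsymm] at h1
  rw [dotProduct_comm a y, dotProduct_comm a x]
  linarith

/-- Submodularity of `log det`: the gain of adding several rank one terms is at most the sum of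
the gains of the single terms. -/
theorem log_det_add_sum_le {ι : Type*} {L : Matrix m m ℝ} (hL : L.PosDef) (S : Finset ι)
    (w : ι → ℝ) (a : ι → m → ℝ) (hw : ∀ e ∈ S, 0 ≤ w e) :
    Real.log (L + ∑ e ∈ S, w e • vecMulVec (a e) (a e)).det ≤
      Real.log L.det + ∑ e ∈ S, Real.log (1 + w e * (a e ⬝ᵥ (L⁻¹ *ᵥ a e))) := by
  classical
  induction S using Finset.induction_on with
  | empty => simp
  | insert e S he ih =>
    have hX : (∑ e ∈ S, w e • vecMulVec (a e) (a e)).PosSemidef :=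
      posSemidef_sum S fun f hf =>
        posSemidef_smul_vecMulVec (hw f (Finset.mem_insert_of_mem hf)) (a f)
    have hLX := hL.add_posSemidef hX
    have hwe := hw e (Finset.mem_insert_self e S)
    have hnn : 0 ≤ a e ⬝ᵥ ((L + ∑ e ∈ S, w e • vecMulVec (a e) (a e))⁻¹ *ᵥ a e) := by
      simpa using hLX.inv.posSemidef.dotProduct_mulVec_nonneg (a e)
    have hle := dotProduct_inv_add_le hL hX (a e)
    -- The gain of `e` on top of `S` is exact here; `hle` then bounds it by its gain at `L` alone.
    rw [Finset.sum_insert he, Finset.sum_insert he, add_comm (w e • _), ← add_assoc,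
      det_add_smul_vecMulVec hLX.det_pos.ne'.isUnit,
      Real.log_mul hLX.det_pos.ne' (by positivity)]
    have hlog := Real.log_le_log (by positivity)
      (add_le_add_right (mul_le_mul_of_nonneg_left hle hwe) 1)
    have := ih fun f hf => hw f (Finset.mem_insert_of_mem hf)
    linarith

theorem log_det_le_log_det_add_sum {ι : Type*} {L : Matrix m m ℝ} (hL : L.PosDef)
    (S : Finset ι) (w : ι → ℝ) (a : ι → m → ℝ) (hw : ∀ e ∈ S, 0 ≤ w e) :
    Real.log L.det ≤ Real.log (L + ∑ e ∈ S, w e • vecMulVec (a e) (a e)).det := by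
  classical
  induction S using Finset.induction_on with
  | empty => simp
  | insert e S he ih =>
    have hw' : ∀ f ∈ S, 0 ≤ w f := fun f hf => hw f (Finset.mem_insert_of_mem hf)
    have hLX := hL.add_posSemidef
      (posSemidef_sum S fun f hf => posSemidef_smul_vecMulVec (hw' f hf) (a f))
    have hwe := hw e (Finset.mem_insert_self e S)
    have hnn : 0 ≤ a e ⬝ᵥ ((L + ∑ e ∈ S, w e • vecMulVec (a e) (a e))⁻¹ *ᵥ a e) := by
      simpa using hLX.inv.posSemidef.dotProduct_mulVec_nonneg (a e)
    refine (ih hw').trans (Real.log_le_log hLX.det_pos ?_)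
    rw [Finset.sum_insert he, add_comm (w e • _), ← add_assoc,
      det_add_smul_vecMulVec hLX.det_pos.ne'.isUnit]
    exact le_mul_of_one_le_right hLX.det_pos.le (le_add_of_nonneg_right (mul_nonneg hwe hnn))

end PosDef

/-! ### Laplacians of connected graphs. -/

section Laplacian

variable {n : ℕ} {v₀ : Fin n} {w : Sym2 (Fin n) → ℝ} {E F : Finset (Sym2 (Fin n))}

theorem posSemidef_redLaplacian (hw : ∀ e ∈ E, 0 ≤ w e) : (redLaplacian v₀ w E).PosSemidef :=
  posSemidef_sum E fun e he => by
    rw [elemLaplacian_eq]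
    exact posSemidef_smul_vecMulVec (hw e he) _

theorem weightedTreeCount_pos (hw : ∀ e ∈ completeEdges n, 0 < w e)
    {G : SimpleGraph (Fin n)} (hG : G.Connected) : 0 < weightedTreeCount w G := by
  classical
  refine Finset.sum_pos (fun T _ => Finset.prod_pos fun e he => hw e ?_) ?_
  · exact SimpleGraph.edgeSet_mono le_top (SimpleGraph.mem_edgeFinset.1 he)
  · obtain ⟨T, hT, hT'⟩ := hG.exists_isTree_le
    exact ⟨T, by simp [spanningTrees, hT, hT']⟩

theorem posDef_redLaplacian (hw : ∀ e ∈ completeEdges n, 0 < w e)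
    (hE : (E : Set (Sym2 (Fin n))) ⊆ completeEdges n) (hconn : (graphOf E).Connected) :
    (redLaplacian v₀ w E).PosDef := by
  rw [(posSemidef_redLaplacian fun e he => (hw e (hE he)).le).posDef_iff_det_ne_zero,
    det_redLaplacian v₀ w hE]
  exact (weightedTreeCount_pos hw hconn).ne'

/-- Connectedness makes the tree count positive, which excludes the default value `0` of
`treeConnectivity`. -/
theorem logTree_eq_log_det (v₀ : Fin n) (hw : ∀ e ∈ completeEdges n, 0 < w e)
    (hE : (E : Set (Sym2 (Fin n))) ⊆ completeEdges n) (hconn : (graphOf E).Connected) :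
    logTree w E = Real.log (redLaplacian v₀ w E).det := by
  rw [logTree, treeConnectivity, if_pos (weightedTreeCount_pos hw hconn), det_redLaplacian v₀ w hE]

theorem graphOf_connected_mono (h : E ⊆ F) (hconn : (graphOf E).Connected) :
    (graphOf F).Connected :=
  hconn.mono (SimpleGraph.fromEdgeSet_mono (by exact_mod_cast h))

theorem redLaplacian_insert {e : Sym2 (Fin n)} (he : e ∉ E) :
    redLaplacian v₀ w (insert e E) = redLaplacian v₀ w E + w e • elemLaplacian v₀ e := by
  rw [redLaplacian, Finset.sum_insert he, add_comm]; rfl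

end Laplacian

/-! ### The greedy guarantee. -/

section Greedy

variable {n : ℕ} {v₀ : Fin n} {w : Sym2 (Fin n) → ℝ} {F M E O : Finset (Sym2 (Fin n))}

theorem redLaplacian_union (A B : Finset (Sym2 (Fin n))) :
    redLaplacian v₀ w (A ∪ B) = redLaplacian v₀ w B +
      ∑ e ∈ A \ B, w e • vecMulVec (edgeVec v₀ e) (edgeVec v₀ e) := by
  simp_rw [← elemLaplacian_eq]
  rw [redLaplacian, redLaplacian, ← Finset.sum_union Finset.disjoint_sdiff]
  congr 1
  simp [Finset.union_comm]

theorem posDef_redLaplacian_union (hF : (redLaplacian v₀ w F).PosDef) (hw : ∀ e ∈ E, 0 ≤ w e) :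
    (redLaplacian v₀ w (E ∪ F)).PosDef := by
  rw [redLaplacian_union]
  exact hF.add_posSemidef (posSemidef_sum _ fun f hf =>
    posSemidef_smul_vecMulVec (hw f (Finset.mem_sdiff.1 hf).1) _)

theorem log_det_redLaplacian_le_union (hF : (redLaplacian v₀ w F).PosDef)
    (hw : ∀ e ∈ E, 0 ≤ w e) :
    Real.log (redLaplacian v₀ w F).det ≤ Real.log (redLaplacian v₀ w (E ∪ F)).det := by
  rw [redLaplacian_union]
  exact log_det_le_log_det_add_sum hF _ _ _ fun e he => hw e (Finset.mem_sdiff.1 he).1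

/-- A candidate edge with the largest `w_e Δ_e` closes at least a fraction `1 / k` of the gap to
any `k` candidate edges. -/
theorem log_det_union_sub_le_mul_gain (hw : ∀ e ∈ M, 0 ≤ w e)
    (hF : (redLaplacian v₀ w F).PosDef) (hE : E ⊆ M) (hO : O ⊆ M)
    {e : Sym2 (Fin n)} (he : IsBestEdge v₀ w (redLaplacian v₀ w (E ∪ F)) (M \ E) e) :
    Real.log (redLaplacian v₀ w (O ∪ F)).det - Real.log (redLaplacian v₀ w (E ∪ F)).det ≤
      O.card * (Real.log (redLaplacian v₀ w (E ∪ F) + w e • elemLaplacian v₀ e).det -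
        Real.log (redLaplacian v₀ w (E ∪ F)).det) := by
  have hL : (redLaplacian v₀ w (E ∪ F)).PosDef :=
    posDef_redLaplacian_union hF fun e he => hw e (hE he)
  -- By monotonicity `O` may be compared on top of the current set, where submodularity applies.
  have h1 : Real.log (redLaplacian v₀ w (O ∪ F)).det ≤
      Real.log (redLaplacian v₀ w (O ∪ (E ∪ F))).det := by
    rw [Finset.union_left_comm]
    exact log_det_redLaplacian_le_union
      (posDef_redLaplacian_union hF fun e he => hw e (hO he)) fun e he => hw e (hE he)
  rw [redLaplacian_union O (E ∪ F)] at h1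
  have h2 := log_det_add_sum_le hL (O \ (E ∪ F)) w (edgeVec v₀)
    fun e he => hw e (hO (Finset.mem_sdiff.1 he).1)
  have hnn : ∀ f, 0 ≤ reff v₀ (redLaplacian v₀ w (E ∪ F)) f := fun f => by
    rw [reff_eq]
    simpa using hL.inv.posSemidef.dotProduct_mulVec_nonneg (edgeVec v₀ f)
  have hwe := hw e (Finset.mem_sdiff.1 he.1).1
  have hprod := mul_nonneg hwe (hnn e)
  rw [elemLaplacian_eq, det_add_smul_vecMulVec hL.det_pos.ne'.isUnit, ← reff_eq,
    Real.log_mul hL.det_pos.ne' (by positivity), add_sub_cancel_left]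
  simp_rw [← reff_eq] at h2
  have h3 : ∑ f ∈ O \ (E ∪ F), Real.log (1 + w f * reff v₀ (redLaplacian v₀ w (E ∪ F)) f) ≤
      (O \ (E ∪ F)).card • Real.log (1 + w e * reff v₀ (redLaplacian v₀ w (E ∪ F)) e) := by
    refine Finset.sum_le_card_nsmul _ _ _ fun f hf => ?_
    obtain ⟨hfO, hfE⟩ := Finset.mem_sdiff.1 hf
    have hwf := mul_nonneg (hw f (hO hfO)) (hnn f)
    refine Real.log_le_log (by positivity) ?_
    have := he.2 f (Finset.mem_sdiff.2
      ⟨hO hfO, fun h => hfE (Finset.mem_union_left _ h)⟩)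
    linarith
  -- Edges of `O` already chosen only lower the count; the gain of `e` is nonnegative.
  have h4 : ((O \ (E ∪ F)).card : ℝ) *
      Real.log (1 + w e * reff v₀ (redLaplacian v₀ w (E ∪ F)) e) ≤
      O.card * Real.log (1 + w e * reff v₀ (redLaplacian v₀ w (E ∪ F)) e) := by
    refine mul_le_mul_of_nonneg_right ?_ (Real.log_nonneg (by linarith))
    exact_mod_cast Finset.card_le_card Finset.sdiff_subset
  rw [nsmul_eq_mul] at h3
  linarith

theorem GreedyState.subset_and_eq (hdisj : Disjoint M F)
    {L : Matrix {i : Fin n // i ≠ v₀} {i : Fin n // i ≠ v₀} ℝ}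
    (h : GreedyState v₀ w F M E L) : E ⊆ M ∧ L = redLaplacian v₀ w (E ∪ F) := by
  induction h with
  | init => simp
  | step E L e hEL he ih =>
    obtain ⟨heM, heE⟩ := Finset.mem_sdiff.1 he.1
    refine ⟨Finset.insert_subset heM ih.1, ?_⟩
    rw [Finset.insert_union, redLaplacian_insert, ih.2]
    exact Finset.notMem_union.2 ⟨heE, Finset.disjoint_left.1 hdisj heM⟩

/-- Each round multiplies the remaining gap by at most `1 - 1 / O.card`, a factor that is
nonnegative since `O` is nonempty. -/
theorem GreedyState.gap_le (hw : ∀ e ∈ M, 0 ≤ w e) (hF : (redLaplacian v₀ w F).PosDef)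
    (hdisj : Disjoint M F) (hO : O ⊆ M) (hpos : 0 < O.card)
    {L : Matrix {i : Fin n // i ≠ v₀} {i : Fin n // i ≠ v₀} ℝ}
    (h : GreedyState v₀ w F M E L) :
    Real.log (redLaplacian v₀ w (O ∪ F)).det - Real.log L.det ≤
      (1 - 1 / (O.card : ℝ)) ^ E.card *
        (Real.log (redLaplacian v₀ w (O ∪ F)).det - Real.log (redLaplacian v₀ w F).det) := by
  induction h with
  | init => simp
  | step E L e hEL he ih =>
    obtain ⟨hEM, rfl⟩ := hEL.subset_and_eq hdisj
    have hgain := log_det_union_sub_le_mul_gain hw hF hEM hO he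
    have hk : (1 : ℝ) ≤ O.card := by exact_mod_cast hpos
    have hk0 : (0 : ℝ) < O.card := by linarith
    rw [Finset.card_insert_of_notMem (Finset.mem_sdiff.1 he.1).2, pow_succ', mul_assoc]
    have h1 : 0 ≤ 1 - 1 / (O.card : ℝ) := sub_nonneg.2 ((div_le_one hk0).2 hk)
    refine le_trans ?_ (mul_le_mul_of_nonneg_left ih h1)
    rw [← div_le_iff₀' hk0] at hgain
    rw [sub_mul, one_mul, one_div_mul_eq_div]
    linarith

theorem exists_isGreedyOutput (v₀ : Fin n) (w : Sym2 (Fin n) → ℝ) (hdisj : Disjoint M F) {k : ℕ}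
    (hk : k ≤ M.card) : ∃ E, IsGreedyOutput v₀ w F M k E := by
  induction k with
  | zero => exact ⟨∅, rfl, _, GreedyState.init⟩
  | succ k ih =>
    obtain ⟨E, hE, L, hL⟩ := ih (by omega)
    have hEM := (hL.subset_and_eq hdisj).1
    have hne : (M \ E).Nonempty := by
      rw [← Finset.card_pos, Finset.card_sdiff_of_subset hEM]
      omega
    obtain ⟨e, he, hmax⟩ := Finset.exists_max_image (M \ E) (fun f => w f * reff v₀ L f) hne
    exact ⟨insert e E, by rw [Finset.card_insert_of_notMem (Finset.mem_sdiff.1 he).2, hE],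
      _, hL.step _ _ e ⟨he, hmax⟩⟩

/-- The approximation guarantee of the greedy algorithm. -/
theorem IsGreedyOutput.log_det_le (hw : ∀ e ∈ M, 0 ≤ w e) (hF : (redLaplacian v₀ w F).PosDef)
    (hdisj : Disjoint M F) (hO : O ⊆ M) (h : IsGreedyOutput v₀ w F M O.card E)
    {ζ : ℝ} (hζ : ζ = (1 - 1 / Real.exp 1)⁻¹) :
    Real.log (redLaplacian v₀ w (O ∪ F)).det ≤
      ζ * Real.log (redLaplacian v₀ w (E ∪ F)).det +
        (1 - ζ) * Real.log (redLaplacian v₀ w F).det := by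
  obtain ⟨hcard, L, hL⟩ := h
  obtain ⟨hEM, rfl⟩ := hL.subset_and_eq hdisj
  -- For `k = 0` both sets are empty and the two sides agree, as `ζ + (1 - ζ) = 1`.
  rcases Nat.eq_zero_or_pos O.card with h0 | hpos
  · rw [h0, Finset.card_eq_zero] at hcard
    rw [Finset.card_eq_zero.1 h0, hcard, Finset.empty_union]
    linarith
  have hgap := hL.gap_le hw hF hdisj hO hpos
  have hnn := log_det_redLaplacian_le_union hF fun e he => hw e (hO he)
  have hpow : (1 - 1 / (O.card : ℝ)) ^ E.card ≤ Real.exp (-1) := by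
    rw [hcard]
    exact Real.one_sub_div_pow_le_exp_neg (by exact_mod_cast hpos)
  have hbound := hgap.trans (mul_le_mul_of_nonneg_right hpow (sub_nonneg.2 hnn))
  have hlt : Real.exp (-1) < 1 := by simp
  have hζ' : ζ * (1 - Real.exp (-1)) = 1 := by
    rw [hζ, one_div, ← Real.exp_neg]
    exact inv_mul_cancel₀ (by linarith)
  have hζ0 : 0 ≤ ζ := by
    by_contra! hneg
    nlinarith
  have := mul_le_mul_of_nonneg_left hbound hζ0
  generalize Real.log (redLaplacian v₀ w (O ∪ F)).det = x at *
  generalize Real.log (redLaplacian v₀ w (E ∪ F)).det = y at *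
  generalize Real.log (redLaplacian v₀ w F).det = z at *
  -- Scaling `x - y ≤ e⁻¹ (x - z)` by `ζ` gives `ζ (x - y) ≤ (ζ - 1) (x - z)`, which rearranges to
  -- the goal.
  have h5 : ζ * Real.exp (-1) = ζ - 1 := by linarith
  have h6 : ζ * (Real.exp (-1) * (x - z)) = (ζ - 1) * (x - z) := by rw [← mul_assoc, h5]
  linarith

end Greedy

/-! ### The convex relaxation. -/

section Convex

variable {n : ℕ} {v₀ : Fin n} {w : Sym2 (Fin n) → ℝ} {F M E O : Finset (Sym2 (Fin n))} {k : ℕ}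

theorem isCompact_cvxFeasible (M : Finset (Sym2 (Fin n))) (k : ℕ) :
    IsCompact (cvxFeasible M k) := by
  refine (isCompact_Icc (a := (0 : M → ℝ)) (b := 1)).of_isClosed_subset ?_ ?_
  · have h : cvxFeasible M k = {p | ∑ e, |p e| = (k : ℝ)} ∩
        ⋂ e, ({p | 0 ≤ p e} ∩ {p | p e ≤ 1}) := by
      ext p
      simp [cvxFeasible]
    rw [h]
    exact (isClosed_eq (by fun_prop) continuous_const).inter (isClosed_iInter fun e =>
      (isClosed_le continuous_const (continuous_apply e)).inter
        (isClosed_le (continuous_apply e) continuous_const))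
  · exact fun p hp => ⟨fun e => (hp.2 e).1, fun e => (hp.2 e).2⟩

theorem posDef_relaxedLaplacian (hw : ∀ e ∈ M, 0 ≤ w e) (hF : (redLaplacian v₀ w F).PosDef)
    {p : M → ℝ} (hp : ∀ e, 0 ≤ p e) : (relaxedLaplacian v₀ w F M p).PosDef := by
  refine hF.add_posSemidef (posSemidef_sum _ fun e _ => ?_)
  rw [elemLaplacian_eq]
  exact (posSemidef_smul_vecMulVec (hw e e.2) _).smul (hp e)

/-- The determinant is a polynomial in `π` and stays positive on the feasible set, so the logarithm
meets no singularity. -/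
theorem continuousOn_cvxObjective (hw : ∀ e ∈ M, 0 ≤ w e) (hF : (redLaplacian v₀ w F).PosDef) :
    ContinuousOn (cvxObjective v₀ w F M) (cvxFeasible M k) := by
  refine ContinuousOn.log (Continuous.continuousOn ?_) fun p hp =>
    (posDef_relaxedLaplacian hw hF fun e => (hp.2 e).1).det_pos.ne'
  refine Continuous.matrix_det ?_
  unfold relaxedLaplacian
  fun_prop

open Classical in
/-- The indicator vector of a set of candidate edges. -/
noncomputable def edgeIndicator (M E : Finset (Sym2 (Fin n))) : M → ℝ :=
  fun e => if (e : Sym2 (Fin n)) ∈ E then 1 else 0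

theorem edgeIndicator_mem_cvxFeasible (hE : E ∈ espFeasible M k) :
    edgeIndicator M E ∈ cvxFeasible M k := by
  classical
  refine ⟨?_, fun e => ?_⟩
  · have h : ∀ e : M, |edgeIndicator M E e| = if (e : Sym2 (Fin n)) ∈ E then 1 else 0 := by
      intro e
      unfold edgeIndicator
      split_ifs <;> simp
    simp_rw [h]
    rw [Finset.sum_coe_sort M fun e => if e ∈ E then (1 : ℝ) else 0, Finset.sum_ite_mem,
      Finset.inter_eq_right.2 hE.1]
    simp [hE.2]
  · unfold edgeIndicator
    split_ifs <;> simp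

theorem relaxedLaplacian_edgeIndicator (hdisj : Disjoint M F) (hE : E ⊆ M) :
    relaxedLaplacian v₀ w F M (edgeIndicator M E) = redLaplacian v₀ w (E ∪ F) := by
  classical
  rw [relaxedLaplacian, redLaplacian,
    Finset.sum_union (Finset.disjoint_of_subset_left hE hdisj), add_comm]
  congr 1
  simp only [edgeIndicator, ite_smul, one_smul, zero_smul]
  rw [Finset.sum_coe_sort M fun e => if e ∈ E then w e • elemLaplacian v₀ e else 0,
    Finset.sum_ite_mem, Finset.inter_eq_right.2 hE]

/-- Repeatedly adjoin an edge with the largest entry among those left. -/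
theorem exists_isTopEdges (p : M → ℝ) (hk : k ≤ M.card) : ∃ E, IsTopEdges M k p E := by
  induction k with
  | zero => exact ⟨∅, by simp, rfl, by simp⟩
  | succ k ih =>
    obtain ⟨E, hEM, hE, htop⟩ := ih (by omega)
    have hne : (Finset.univ.filter fun f : M => (f : Sym2 (Fin n)) ∉ E).Nonempty := by
      obtain ⟨f, hf⟩ : (M \ E).Nonempty := by
        rw [← Finset.card_pos, Finset.card_sdiff_of_subset hEM]
        omega
      exact ⟨⟨f, (Finset.mem_sdiff.1 hf).1⟩, by simpa using (Finset.mem_sdiff.1 hf).2⟩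
    obtain ⟨f, hf, hmax⟩ := Finset.exists_max_image _ p hne
    have hfE : (f : Sym2 (Fin n)) ∉ E := (Finset.mem_filter.1 hf).2
    refine ⟨insert (f : Sym2 (Fin n)) E, Finset.insert_subset f.2 hEM,
      by rw [Finset.card_insert_of_notMem hfE, hE], fun e g he hg => ?_⟩
    have hgE : (g : Sym2 (Fin n)) ∉ E := fun h => hg (Finset.mem_insert_of_mem h)
    rcases Finset.mem_insert.1 he with he | he
    · rw [Subtype.ext he]
      exact hmax g (by simpa using hgE)
    · exact htop e g he hgE

theorem espFeasible_nonempty (hk : k ≤ M.card) : (espFeasible M k).Nonempty :=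
  Finset.exists_subset_card_eq hk

theorem isGreatest_espOPT (w : Sym2 (Fin n) → ℝ) (F : Finset (Sym2 (Fin n)))
    (hk : k ≤ M.card) : IsGreatest (espValues w F M k) (espOPT w F M k) := by
  have hfin : (espValues w F M k).Finite := (Set.toFinite _).image _
  exact ⟨((espFeasible_nonempty hk).image _).csSup_mem hfin,
    fun x hx => le_csSup hfin.bddAbove hx⟩

theorem isGreatest_cvxOPT (hw : ∀ e ∈ M, 0 ≤ w e) (hF : (redLaplacian v₀ w F).PosDef)
    (hk : k ≤ M.card) : IsGreatest (cvxValues v₀ w F M k) (cvxOPT v₀ w F M k) := by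
  obtain ⟨E, hE⟩ := espFeasible_nonempty hk
  exact ((isCompact_cvxFeasible M k).image_of_continuousOn
    (continuousOn_cvxObjective hw hF)).isGreatest_sSup
    (Set.Nonempty.image _ ⟨_, edgeIndicator_mem_cvxFeasible hE⟩)

theorem exists_isCvxOutput (hw : ∀ e ∈ M, 0 ≤ w e) (hF : (redLaplacian v₀ w F).PosDef)
    (hk : k ≤ M.card) : ∃ E, IsCvxOutput v₀ w F M k E := by
  obtain ⟨⟨p, hp, hpv⟩, hmax⟩ := isGreatest_cvxOPT hw hF hk
  obtain ⟨E, hE⟩ := exists_isTopEdges p hk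
  exact ⟨E, p, ⟨hp, fun q hq => hpv ▸ hmax ⟨q, hq, rfl⟩⟩, hE⟩

end Convex

end ESP

/-! ### Assembly of the bounds. -/

theorem mainTheorem7 (n : ℕ) (hn : 2 ≤ n) (v₀ : Fin n)
    (w : Sym2 (Fin n) → ℝ) (hw : ∀ e ∈ ESP.completeEdges n, 0 < w e)
    (Einit : Finset (Sym2 (Fin n)))
    (hEinit : (Einit : Set (Sym2 (Fin n))) ⊆ ESP.completeEdges n)
    (hconn : (ESP.graphOf Einit).Connected)
    (Mplus : Finset (Sym2 (Fin n)))
    (hMplus : (Mplus : Set (Sym2 (Fin n))) ⊆ ESP.completeEdges n \ (Einit : Set (Sym2 (Fin n))))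
    (k : ℕ) (hk : k ≤ Mplus.card) :
    IsGreatest (ESP.espValues w Einit Mplus k) (ESP.espOPT w Einit Mplus k) ∧
    IsGreatest (ESP.cvxValues v₀ w Einit Mplus k) (ESP.cvxOPT v₀ w Einit Mplus k) ∧
    (∃ Egreedy, ESP.IsGreedyOutput v₀ w Einit Mplus k Egreedy) ∧
    (∃ Ecvx, ESP.IsCvxOutput v₀ w Einit Mplus k Ecvx) ∧
    ∀ Egreedy Ecvx : Finset (Sym2 (Fin n)),
      ESP.IsGreedyOutput v₀ w Einit Mplus k Egreedy →
      ESP.IsCvxOutput v₀ w Einit Mplus k Ecvx →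
      ∀ ζ : ℝ, ζ = (1 - 1 / Real.exp 1)⁻¹ →
        max (ESP.logTree w (Egreedy ∪ Einit)) (ESP.logTree w (Ecvx ∪ Einit))
            ≤ ESP.espOPT w Einit Mplus k ∧
        ESP.espOPT w Einit Mplus k
            ≤ min (ζ * ESP.logTree w (Egreedy ∪ Einit) + (1 - ζ) * ESP.logTree w Einit)
                (ESP.cvxOPT v₀ w Einit Mplus k) := by
  have hdisj : Disjoint Mplus Einit :=
    Finset.disjoint_left.2 fun e he => (hMplus he).2
  have hwM : ∀ e ∈ Mplus, 0 ≤ w e := fun e he => (hw e (hMplus he).1).le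
  have hF : (ESP.redLaplacian v₀ w Einit).PosDef := ESP.posDef_redLaplacian hw hEinit hconn
  have hlog : ∀ E ⊆ Mplus, ESP.logTree w (E ∪ Einit) =
      Real.log (ESP.redLaplacian v₀ w (E ∪ Einit)).det := by
    intro E hE
    refine ESP.logTree_eq_log_det v₀ hw ?_
      (ESP.graphOf_connected_mono Finset.subset_union_right hconn)
    intro e he
    rcases Finset.mem_union.1 he with he | he
    · exact (hMplus (hE he)).1
    · exact hEinit he
  have hesp := ESP.isGreatest_espOPT w Einit hk
  have hcvx := ESP.isGreatest_cvxOPT hwM hF hk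
  refine ⟨hesp, hcvx, ESP.exists_isGreedyOutput v₀ w hdisj hk,
    ESP.exists_isCvxOutput hwM hF hk, ?_⟩
  intro Egreedy Ecvx hgreedy hEcvx ζ hζ
  obtain ⟨hcard, L, hL⟩ := id hgreedy
  have hEM := (hL.subset_and_eq hdisj).1
  obtain ⟨p, _, hcM, hccard, _⟩ := hEcvx
  -- Both outputs are `k`-subsets of the candidates, so neither exceeds the optimum.
  refine ⟨max_le (hesp.2 ⟨Egreedy, ⟨hEM, hcard⟩, rfl⟩)
    (hesp.2 ⟨Ecvx, ⟨hcM, hccard⟩, rfl⟩), ?_⟩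
  obtain ⟨⟨O, hO, hOPT⟩, _⟩ := hesp
  rw [← hOPT]
  simp only
  rw [hlog O hO.1, hlog Egreedy hEM, ESP.logTree_eq_log_det v₀ hw hEinit hconn]
  refine le_min ?_ ?_
  · exact ESP.IsGreedyOutput.log_det_le hwM hF hdisj hO.1 (by rwa [hO.2]) hζ
  -- The indicator of an optimal set `O` attains `OPT` in the relaxation.
  · refine hcvx.2 ⟨ESP.edgeIndicator Mplus O, ESP.edgeIndicator_mem_cvxFeasible hO, ?_⟩
    rw [ESP.cvxObjective, ESP.relaxedLaplacian_edgeIndicator hdisj hO.1]
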